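/- Let $L$ be a frame with bottom $0$, top $1$ and pseudocomplement $a^*$, and let $\mathcal{R}L$ be the ring of frame homomorphisms $\mathfrak{O}\mathbb{R}\to L$ (equivalently $\mathcal{L}(\mathbb{R})\to L$), with the usual operations: for $\diamond\in\{+,\cdot\}$, $(\alpha\diamond\beta)(W)=\bigvee\{\alpha(U)\wedge\beta(V) : U\diamond V\subseteq W\}$ over open $U,V\subseteq\mathbb{R}$. For $r\in\mathbb{R}$ let $\mathbf{r}\in\mathcal{R}L$ be the constant, with $\mathbf{r}(U)=1$ if $r\in U$ and $\mathbf{r}(U)=0$ otherwise. Put $\operatorname{coz}\alpha=\alpha(-\infty,0)\vee\alpha(0,\infty)$, $R_\alpha=\{r\in\mathbb{R} : \operatorname{coz}(\alpha-\mathbf{r})\neq 1\}$ and $\mathcal{R}_cL=\{\alpha\in\mathcal{R}L : R_\alpha\text{ is countable}\}$. An ideal of $\mathcal{R}_cL$ is a set $Q\subseteq\mathcal{R}_cL$ that contains $\mathbf{0}$, is closed under addition, and satisfies $\alpha\beta\in Q$ for all $\alpha\in\mathcal{R}_cL$, $\beta\in Q$ (if $\mathcal{R}_cL$ is a subring of $\mathcal{R}L$,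 these are its ring ideals; $Q=\mathcal{R}_cL$ is then allowed). Let $BL=\{a\in L : a\vee a^*=1\}$, let $\beta_0L$ be the frame of lattice ideals of $BL$, ordered by inclusion, and put $r_0(a)=\{x\in BL : x\le a\}$ for $a\in L$. For $I\in\beta_0L$ put $$\mathbf{M}_c^I=\{\alpha\in\mathcal{R}_cL : r_0(\operatorname{coz}\alpha)\subseteq I\},\qquad \mathbf{O}_c^I=\{\alpha\in\mathcal{R}_cL : I\vee r_0((\operatorname{coz}\alpha)^*)=1_{\beta_0L}\}.$$ Write $a\prec b$ if $a^*\vee b=1$, and $a\prec\!\!\prec b$ if there are $a_q\in L$ $(q\in\mathbb{Q}\cap[0,1])$ with $a_0=a$, $a_1=b$ and $a_p\prec a_q$ whenever $p<q$. Then $\mathbf{O}_c^I=\{\alpha\in\mathcal{R}_cL : \operatorname{coz}\alpha\prec\!\!\prec\operatorname{coz}\delta\in I\text{ for some }\delta\in\mathcal{R}_cL\}$ for every $I\in\beta_0L$, and for every ideal $Q$ of $\mathcal{R}_cL$ there is $I\in\beta_0L$ such that $$\mathbf{O}_c^I\subseteq Q\subseteq\mathbf{M}_c^I.$$ -/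

import Mathlib

open TopologicalSpace

namespace PointfreeReals

universe u v w

/-! ### Copairing of frame homomorphisms on a product of spaces -/

section Pairing

variable {X : Type v} {Y : Type w} [TopologicalSpace X] [TopologicalSpace Y]
variable {L : Type u} [Order.Frame L]

/-- The open rectangle `U × V`. -/
def rect (U : Opens X) (V : Opens Y) : Opens (X × Y) := ⟨(U : Set X) ×ˢ (V : Set Y),
  U.isOpen.prod V.isOpen⟩

/-- The join of all `α U ⊓ β V` over the open rectangles `U × V` contained in `W`. -/
def pairFun (α : FrameHom (Opens X) L) (β : FrameHom (Opens Y) L) (W : Opens (X × Y)) : L :=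
  ⨆ (U : Opens X) (V : Opens Y) (_ : rect U V ≤ W), α U ⊓ β V

theorem le_pairFun {α : FrameHom (Opens X) L} {β : FrameHom (Opens Y) L} {W : Opens (X × Y)}
    {U : Opens X} {V : Opens Y} (h : rect U V ≤ W) : α U ⊓ β V ≤ pairFun α β W :=
  le_iSup_of_le U (le_iSup_of_le V (le_iSup_of_le h le_rfl))

theorem pairFun_le {α : FrameHom (Opens X) L} {β : FrameHom (Opens Y) L} {W : Opens (X × Y)}
    {c : L} (h : ∀ (U : Opens X) (V : Opens Y), rect U V ≤ W → α U ⊓ β V ≤ c) :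
    pairFun α β W ≤ c :=
  iSup_le fun U => iSup_le fun V => iSup_le fun hUV => h U V hUV

theorem pairFun_mono (α : FrameHom (Opens X) L) (β : FrameHom (Opens Y) L)
    {W W' : Opens (X × Y)} (h : W ≤ W') : pairFun α β W ≤ pairFun α β W' :=
  pairFun_le fun _ _ hUV => le_pairFun (hUV.trans h)

theorem pairFun_top (α : FrameHom (Opens X) L) (β : FrameHom (Opens Y) L) :
    pairFun α β ⊤ = ⊤ := by
  refine top_le_iff.mp ?_
  have h := le_pairFun (α := α) (β := β) (U := ⊤) (V := ⊤) (W := ⊤) le_top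
  simpa using h

theorem pairFun_inf (α : FrameHom (Opens X) L) (β : FrameHom (Opens Y) L)
    (W W' : Opens (X × Y)) : pairFun α β (W ⊓ W') = pairFun α β W ⊓ pairFun α β W' := by
  apply le_antisymm
  · exact le_inf (pairFun_mono α β inf_le_left) (pairFun_mono α β inf_le_right)
  · conv_lhs => simp only [pairFun, iSup_inf_eq, inf_iSup_eq]
    refine iSup_le fun U => iSup_le fun V => iSup_le fun h => iSup_le fun U' => iSup_le fun V' =>
      iSup_le fun h' => ?_
    have key : rect (U ⊓ U') (V ⊓ V') ≤ W ⊓ W' := by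
      rintro ⟨x, y⟩ ⟨hx, hy⟩
      exact ⟨h' ⟨hx.2, hy.2⟩, h ⟨hx.1, hy.1⟩⟩
    refine le_trans (le_of_eq ?_) (le_pairFun key)
    rw [map_inf, map_inf, inf_inf_inf_comm, inf_comm (α U'), inf_comm (β V')]

theorem pairFun_sSup [LocallyCompactSpace X] (α : FrameHom (Opens X) L)
    (β : FrameHom (Opens Y) L) (S : Set (Opens (X × Y))) :
    pairFun α β (sSup S) = sSup (pairFun α β '' S) := by
  apply le_antisymm
  · set c := sSup (pairFun α β '' S) with hc
    have hS : ∀ W ∈ S, pairFun α β W ≤ c := fun W hW => le_sSup ⟨W, hW, rfl⟩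
    refine pairFun_le fun U V hUV => ?_
    -- shrink `U` to open sets contained in a compact subset of `U`
    have hU : U ≤ sSup {U₀ : Opens X | ∃ K : Set X, IsCompact K ∧ (U₀ : Set X) ⊆ K ∧
        K ⊆ (U : Set X)} := by
      intro x hx
      obtain ⟨K, hK, hxK, hKU⟩ := exists_compact_subset U.isOpen hx
      exact Opens.mem_sSup.mpr
        ⟨⟨interior K, isOpen_interior⟩, ⟨K, hK, interior_subset, hKU⟩, hxK⟩
    refine le_trans (inf_le_inf_right _ (OrderHomClass.mono α hU)) ?_
    rw [map_sSup, sSup_inf_eq]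
    refine iSup₂_le ?_
    rintro _ ⟨U₀, ⟨K, hK, hU₀K, hKU⟩, rfl⟩
    have hV : V ≤ sSup {V₀ : Opens Y | α U₀ ⊓ β V₀ ≤ c} := by
      intro y hy
      let R : Type _ := {p : Opens X × Opens Y // y ∈ p.2 ∧ ∃ W ∈ S, rect p.1 p.2 ≤ W}
      have hcov : K ⊆ ⋃ i : R, (i.1.1 : Set X) := by
        intro x hx
        have hxy : (x, y) ∈ sSup S := hUV ⟨hKU hx, hy⟩
        obtain ⟨W, hW, hxW⟩ := Opens.mem_sSup.mp hxy
        obtain ⟨A, B, hA, hB, hxA, hyB, hAB⟩ := isOpen_prod_iff.mp W.isOpen x y hxW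
        exact Set.mem_iUnion.mpr ⟨⟨(⟨A, hA⟩, ⟨B, hB⟩), hyB, W, hW, hAB⟩, hxA⟩
      obtain ⟨t, ht⟩ := hK.elim_finite_subcover (fun i : R => (i.1.1 : Set X))
        (fun i => i.1.1.isOpen) hcov
      refine Opens.mem_sSup.mpr ⟨t.inf fun i => i.1.2, ?_, ?_⟩
      · have h1 : U₀ ≤ ⨆ i ∈ t, i.1.1 := by
          intro x hx
          have := ht (hU₀K hx)
          simpa [Opens.mem_iSup] using this
        refine le_trans (inf_le_inf_right _ (OrderHomClass.mono α h1)) ?_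
        rw [map_iSup, iSup_inf_eq]
        refine iSup_le fun i => ?_
        rw [map_iSup, iSup_inf_eq]
        refine iSup_le fun hi => ?_
        obtain ⟨W, hW, hiW⟩ := i.2.2
        exact le_trans (inf_le_inf_left _ (OrderHomClass.mono β (Finset.inf_le hi)))
          ((le_pairFun hiW).trans (hS W hW))
      · have : ∀ s : Finset R, y ∈ s.inf fun i => i.1.2 := by
          classical
          intro s
          induction s using Finset.induction_on with
          | empty => simp
          | insert a s _ ih => rw [Finset.inf_insert]; exact ⟨a.2.1, ih⟩
        exact this t
    refine le_trans (inf_le_inf_left _ (OrderHomClass.mono β hV)) ?_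
    rw [map_sSup, inf_sSup_eq]
    refine iSup₂_le ?_
    rintro _ ⟨V₀, hV₀, rfl⟩
    exact hV₀
  · refine sSup_le ?_
    rintro _ ⟨W, hW, rfl⟩
    exact pairFun_mono α β (le_sSup hW)

/-- The frame homomorphism `𝔒(X × Y) → L` induced by `α : 𝔒X → L` and `β : 𝔒Y → L`. -/
def pair [LocallyCompactSpace X] (α : FrameHom (Opens X) L) (β : FrameHom (Opens Y) L) :
    FrameHom (Opens (X × Y)) L where
  toFun := pairFun α β
  map_inf' := pairFun_inf α β
  map_top' := pairFun_top α β
  map_sSup' := pairFun_sSup α β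

theorem pair_prod [LocallyCompactSpace X] (α : FrameHom (Opens X) L)
    (β : FrameHom (Opens Y) L) (U : Opens X) (V : Opens Y) :
    pair α β (rect U V) = α U ⊓ β V := by
  apply le_antisymm
  · refine pairFun_le fun U' V' h => ?_
    by_cases hU : U' = ⊥
    · simp [hU]
    by_cases hV : V' = ⊥
    · simp [hV]
    obtain ⟨x, hx⟩ := (Opens.ne_bot_iff_nonempty U').mp hU
    obtain ⟨y, hy⟩ := (Opens.ne_bot_iff_nonempty V').mp hV
    have h1 : U' ≤ U := fun z hz => (h (show (z, y) ∈ rect U' V' from ⟨hz, hy⟩)).1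
    have h2 : V' ≤ V := fun z hz => (h (show (x, z) ∈ rect U' V' from ⟨hx, hz⟩)).2
    exact inf_le_inf (OrderHomClass.mono α h1) (OrderHomClass.mono β h2)
  · exact le_pairFun le_rfl

/-- A frame homomorphism on `𝔒(X × Y)` is determined by its values on open rectangles. -/
theorem hom_ext_prod {P P' : FrameHom (Opens (X × Y)) L}
    (h : ∀ (U : Opens X) (V : Opens Y), P (rect U V) = P' (rect U V)) : P = P' := by
  refine FrameHom.ext fun W => ?_
  have hW : W = sSup {R | ∃ (U : Opens X) (V : Opens Y), R = rect U V ∧ R ≤ W} := by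
    apply le_antisymm
    · rintro ⟨x, y⟩ hxy
      obtain ⟨A, B, hA, hB, hxA, hyB, hAB⟩ := isOpen_prod_iff.mp W.isOpen x y hxy
      exact Opens.mem_sSup.mpr
        ⟨rect ⟨A, hA⟩ ⟨B, hB⟩, ⟨⟨A, hA⟩, ⟨B, hB⟩, rfl, hAB⟩, ⟨hxA, hyB⟩⟩
    · exact sSup_le fun R hR => hR.choose_spec.choose_spec.2
  rw [hW, map_sSup, map_sSup]
  congr 1
  refine Set.image_congr ?_
  rintro _ ⟨U, V, rfl, _⟩
  exact h U V

theorem pair_comp_comap {T : Type*} [TopologicalSpace T] [LocallyCompactSpace X]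
    (P : FrameHom (Opens T) L) (f : C(T, X)) (g : C(T, Y)) :
    pair (P.comp (Opens.comap f)) (P.comp (Opens.comap g)) =
      P.comp (Opens.comap (f.prodMk g)) := by
  refine hom_ext_prod fun U V => ?_
  rw [pair_prod, FrameHom.comp_apply, FrameHom.comp_apply, FrameHom.comp_apply, ← map_inf]
  rfl

theorem pair_comp_fst [LocallyCompactSpace X] (α : FrameHom (Opens X) L)
    (β : FrameHom (Opens Y) L) : (pair α β).comp (Opens.comap ContinuousMap.fst) = α := by
  refine FrameHom.ext fun U => ?_
  have h : Opens.comap (ContinuousMap.fst : C(X × Y, X)) U = rect U ⊤ := by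
    ext ⟨x, y⟩; simp [rect]
  rw [FrameHom.comp_apply, h, pair_prod, map_top, inf_top_eq]

theorem pair_comp_snd [LocallyCompactSpace X] (α : FrameHom (Opens X) L)
    (β : FrameHom (Opens Y) L) : (pair α β).comp (Opens.comap ContinuousMap.snd) = β := by
  refine FrameHom.ext fun V => ?_
  have h : Opens.comap (ContinuousMap.snd : C(X × Y, Y)) V = rect ⊤ V := by
    ext ⟨x, y⟩; simp [rect]
  rw [FrameHom.comp_apply, h, pair_prod, map_top, top_inf_eq]

end Pairing

/-! ### The ring `ℛL` -/

/-- `ℛL`: the frame homomorphisms `𝔏(ℝ) → L`, where the frame of reals `𝔏(ℝ)` is taken to be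
the (isomorphic) frame of open subsets of `ℝ`. -/
abbrev RL (L : Type u) [Order.Frame L] : Type u := FrameHom (Opens ℝ) L

section Ring

variable {L : Type u} [Order.Frame L]

/-- The constant function `𝐫`: it maps an open set `U` to `⊤` if `r ∈ U`, and to `⊥` otherwise. -/
def const (L : Type u) [Order.Frame L] (r : ℝ) : RL L where
  toFun U := ⨆ _ : r ∈ U, ⊤
  map_inf' U V := by
    by_cases hU : r ∈ U <;> by_cases hV : r ∈ V <;> simp [hU, hV]
  map_top' := by simp
  map_sSup' S := by
    apply le_antisymm
    · refine iSup_le fun h => ?_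
      obtain ⟨U, hU, hr⟩ := Opens.mem_sSup.mp h
      exact le_sSup_of_le ⟨U, hU, rfl⟩ (by simp [hr])
    · refine sSup_le ?_
      rintro _ ⟨U, hU, rfl⟩
      exact iSup_le fun hr => le_iSup_of_le (Opens.mem_sSup.mpr ⟨U, hU, hr⟩) le_rfl

/-- Addition: `(α + β)(W)` is the join of all `α U ⊓ β V` with `U + V ⊆ W`. -/
instance : Add (RL L) where
  add α β := (pair α β).comp (Opens.comap ⟨fun p : ℝ × ℝ => p.1 + p.2, by fun_prop⟩)

/-- Multiplication: `(α * β)(W)` is the join of all `α U ⊓ β V` with `U * V ⊆ W`. -/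
instance : Mul (RL L) where
  mul α β := (pair α β).comp (Opens.comap ⟨fun p : ℝ × ℝ => p.1 * p.2, by fun_prop⟩)

/-- Negation: `(-α)(W) = α(-W)`. -/
instance : Neg (RL L) where
  neg α := α.comp (Opens.comap ⟨fun x : ℝ => -x, by fun_prop⟩)

instance : Zero (RL L) := ⟨const L 0⟩

instance : One (RL L) := ⟨const L 1⟩

theorem add_apply (α β : RL L) (W : Opens ℝ) :
    (α + β) W = ⨆ (U : Opens ℝ) (V : Opens ℝ) (_ : ∀ x ∈ U, ∀ y ∈ V, x + y ∈ W), α U ⊓ β V := by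
  have h : ∀ U V : Opens ℝ, (rect U V ≤ Opens.comap ⟨fun p : ℝ × ℝ => p.1 + p.2, by fun_prop⟩ W)
      = (∀ x ∈ U, ∀ y ∈ V, x + y ∈ W) := fun U V =>
    propext ⟨fun h x hx y hy => h (show (x, y) ∈ rect U V from ⟨hx, hy⟩),
      fun h p hp => h p.1 hp.1 p.2 hp.2⟩
  simp only [← h]
  rfl

theorem mul_apply (α β : RL L) (W : Opens ℝ) :
    (α * β) W = ⨆ (U : Opens ℝ) (V : Opens ℝ) (_ : ∀ x ∈ U, ∀ y ∈ V, x * y ∈ W), α U ⊓ β V := by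
  have h : ∀ U V : Opens ℝ, (rect U V ≤ Opens.comap ⟨fun p : ℝ × ℝ => p.1 * p.2, by fun_prop⟩ W)
      = (∀ x ∈ U, ∀ y ∈ V, x * y ∈ W) := fun U V =>
    propext ⟨fun h x hx y hy => h (show (x, y) ∈ rect U V from ⟨hx, hy⟩),
      fun h p hp => h p.1 hp.1 p.2 hp.2⟩
  simp only [← h]
  rfl

section Act

variable {T : Type v} [TopologicalSpace T]

/-- A frame homomorphism `P : 𝔒T → L` turns continuous functions on `T` into elements of `ℛL`. -/
def act (P : FrameHom (Opens T) L) (f : C(T, ℝ)) : RL L := P.comp (Opens.comap f)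

theorem act_add (P : FrameHom (Opens T) L) (f g : C(T, ℝ)) :
    act P (f + g) = act P f + act P g := by
  change _ = (pair (P.comp _) (P.comp _)).comp _
  rw [pair_comp_comap]
  rfl

theorem act_mul (P : FrameHom (Opens T) L) (f g : C(T, ℝ)) :
    act P (f * g) = act P f * act P g := by
  change _ = (pair (P.comp _) (P.comp _)).comp _
  rw [pair_comp_comap]
  rfl

theorem act_neg (P : FrameHom (Opens T) L) (f : C(T, ℝ)) : act P (-f) = -act P f := rfl

theorem act_const (P : FrameHom (Opens T) L) (r : ℝ) :
    act P (ContinuousMap.const T r) = const L r := by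
  refine FrameHom.ext fun U => ?_
  change P (Opens.comap (ContinuousMap.const T r) U) = ⨆ _ : r ∈ U, ⊤
  by_cases hr : r ∈ U
  · have : Opens.comap (ContinuousMap.const T r) U = ⊤ := by
      ext x; simp [hr]
    rw [this, map_top]; simp [hr]
  · have : Opens.comap (ContinuousMap.const T r) U = ⊥ := by
      ext x; simp [hr]
    rw [this, map_bot]; simp [hr]

theorem act_zero (P : FrameHom (Opens T) L) : act P 0 = 0 := act_const P 0

theorem act_one (P : FrameHom (Opens T) L) : act P 1 = 1 := act_const P 1

end Act

/-- Any three elements of `ℛL` come from three continuous functions on one space. -/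
theorem exists_act (α β γ : RL L) : ∃ (P : FrameHom (Opens ((ℝ × ℝ) × ℝ)) L)
    (f g h : C((ℝ × ℝ) × ℝ, ℝ)), α = act P f ∧ β = act P g ∧ γ = act P h := by
  refine ⟨pair (pair α β) γ, ContinuousMap.fst.comp ContinuousMap.fst,
    ContinuousMap.snd.comp ContinuousMap.fst, ContinuousMap.snd, ?_, ?_, ?_⟩
  · rw [act, Opens.comap_comp, ← FrameHom.comp_assoc, pair_comp_fst, pair_comp_fst]
  · rw [act, Opens.comap_comp, ← FrameHom.comp_assoc, pair_comp_fst, pair_comp_snd]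
  · rw [act, pair_comp_snd]

instance : CommRing (RL L) where
  add_assoc α β γ := by
    obtain ⟨P, f, g, h, rfl, rfl, rfl⟩ := exists_act α β γ
    simp only [← act_add, add_assoc]
  zero_add α := by
    obtain ⟨P, f, g, h, rfl, -, -⟩ := exists_act α α α
    rw [← act_zero P, ← act_add, zero_add]
  add_zero α := by
    obtain ⟨P, f, g, h, rfl, -, -⟩ := exists_act α α α
    rw [← act_zero P, ← act_add, add_zero]
  add_comm α β := by
    obtain ⟨P, f, g, h, rfl, rfl, -⟩ := exists_act α β β
    simp only [← act_add, add_comm]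
  left_distrib α β γ := by
    obtain ⟨P, f, g, h, rfl, rfl, rfl⟩ := exists_act α β γ
    simp only [← act_add, ← act_mul, mul_add]
  right_distrib α β γ := by
    obtain ⟨P, f, g, h, rfl, rfl, rfl⟩ := exists_act α β γ
    simp only [← act_add, ← act_mul, add_mul]
  zero_mul α := by
    obtain ⟨P, f, g, h, rfl, -, -⟩ := exists_act α α α
    rw [← act_zero P, ← act_mul, zero_mul]
  mul_zero α := by
    obtain ⟨P, f, g, h, rfl, -, -⟩ := exists_act α α α
    rw [← act_zero P, ← act_mul, mul_zero]
  mul_assoc α β γ := by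
    obtain ⟨P, f, g, h, rfl, rfl, rfl⟩ := exists_act α β γ
    simp only [← act_mul, mul_assoc]
  one_mul α := by
    obtain ⟨P, f, g, h, rfl, -, -⟩ := exists_act α α α
    rw [← act_one P, ← act_mul, one_mul]
  mul_one α := by
    obtain ⟨P, f, g, h, rfl, -, -⟩ := exists_act α α α
    rw [← act_one P, ← act_mul, mul_one]
  mul_comm α β := by
    obtain ⟨P, f, g, h, rfl, rfl, -⟩ := exists_act α β β
    simp only [← act_mul, mul_comm]
  neg_add_cancel α := by
    obtain ⟨P, f, g, h, rfl, -, -⟩ := exists_act α α α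
    rw [← act_neg, ← act_add, neg_add_cancel, act_zero]
  nsmul := nsmulRec
  zsmul := zsmulRec

end Ring

/-! ### Cozero elements, pointfree images and `ℛ_c L` -/

section Rc

variable {L : Type u} [Order.Frame L]

/-- `coz α = α(-,0) ∨ α(0,-)`. -/
def coz (α : RL L) : L := α ⟨Set.Iio 0, isOpen_Iio⟩ ⊔ α ⟨Set.Ioi 0, isOpen_Ioi⟩

/-- The pointfree image `R_α = {r ∈ ℝ | coz (α - 𝐫) ≠ 1}`. -/
def pointfreeImage (α : RL L) : Set ℝ := {r | coz (α - const L r) ≠ ⊤}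

/-- `ℛ_c L`: the elements of `ℛL` whose pointfree image is countable. -/
def Rc (L : Type u) [Order.Frame L] : Set (RL L) := {α | (pointfreeImage α).Countable}

/-- `Q` is an ideal of `ℛ_c L`, under the operations of `ℛL`. (Closure under negation is automatic,
as `-𝟏 ∈ ℛ_c L`; see `isRcIdeal_iff` for the comparison with the ideals of a subring.) -/
structure IsRcIdeal (Q : Set (RL L)) : Prop where
  subset : Q ⊆ Rc L
  zero_mem : (0 : RL L) ∈ Q
  add_mem : ∀ {α β : RL L}, α ∈ Q → β ∈ Q → α + β ∈ Q
  mul_mem : ∀ {α β : RL L}, α ∈ Rc L → β ∈ Q → α * β ∈ Q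

/-- If `ℛ_c L` is a subring of `ℛL`, then `IsRcIdeal` singles out exactly its ideals. -/
theorem isRcIdeal_iff (S : Subring (RL L)) (hS : (S : Set (RL L)) = Rc L) (Q : Set (RL L)) :
    IsRcIdeal Q ↔ ∃ J : Ideal S, Q = Subtype.val '' (J : Set S) := by
  have hmem : ∀ α, α ∈ S ↔ α ∈ Rc L := fun α => by rw [← hS]; rfl
  constructor
  · intro h
    refine ⟨{ carrier := {x | (x : RL L) ∈ Q}
              zero_mem' := h.zero_mem
              add_mem' := @fun a b ha hb => by
                rw [Set.mem_ofPred_eq, Subring.coe_add]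
                exact h.add_mem ha hb
              smul_mem' := fun c x hx => by
                rw [Set.mem_ofPred_eq, smul_eq_mul, Subring.coe_mul]
                exact h.mul_mem ((hmem _).mp c.2) hx }, ?_⟩
    ext α
    exact ⟨fun hα => ⟨⟨α, (hmem _).mpr (h.subset hα)⟩, hα, rfl⟩, by rintro ⟨x, hx, rfl⟩; exact hx⟩
  · rintro ⟨J, rfl⟩
    refine ⟨?_, ⟨0, J.zero_mem, rfl⟩, ?_, ?_⟩
    · rintro _ ⟨x, _, rfl⟩
      exact (hmem _).mp x.2
    · rintro _ _ ⟨x, hx, rfl⟩ ⟨y, hy, rfl⟩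
      exact ⟨x + y, J.add_mem hx hy, Subring.coe_add S x y⟩
    · rintro α _ hα ⟨y, hy, rfl⟩
      exact ⟨(⟨α, (hmem _).mpr hα⟩ : S) * y, J.mul_mem_left _ hy, Subring.coe_mul S _ _⟩

end Rc

/-! ### Rather below, completely below, `β₀L` and its right adjoint `r₀` -/

section BetaZero

variable {L : Type u} [Order.Frame L]

/-- `a ≺ b`: the pseudocomplement of `a` joined with `b` is the top. -/
def RatherBelow (a b : L) : Prop := aᶜ ⊔ b = ⊤

/-- `a ≺≺ b`: there is a family `(s q)` indexed by `ℚ ∩ [0,1]` from `a` to `b` with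
`s p ≺ s q` whenever `p < q`. -/
def CompletelyBelow (a b : L) : Prop :=
  ∃ s : Set.Icc (0 : ℚ) 1 → L, s 0 = a ∧ s 1 = b ∧ ∀ p q, p < q → RatherBelow (s p) (s q)

/-- `β₀L`: the frame of lattice ideals of the lattice `BL` of complemented elements of `L`. -/
abbrev BetaZero (L : Type u) [Order.Frame L] : Type u := Order.Ideal (Complementeds L)

/-- `r₀ a = ↓a ∩ BL`. -/
def rZero (a : L) : BetaZero L where
  carrier := {x | (x : L) ≤ a}
  lower' := fun _ _ hyx hx => le_trans (show _ ≤ _ from hyx) hx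
  nonempty' := ⟨⊥, bot_le⟩
  directed' := fun x hx y hy =>
    ⟨x ⊔ y, show ((x ⊔ y : Complementeds L) : L) ≤ a from sup_le hx hy, le_sup_left, le_sup_right⟩

/-- `𝐌_c^I = {α ∈ ℛ_c L | r₀(coz α) ⊆ I}`. -/
def Mc (I : BetaZero L) : Set (RL L) := {α | α ∈ Rc L ∧ rZero (coz α) ≤ I}

/-- `𝐎_c^I = {α ∈ ℛ_c L | I ∨ r₀((coz α)*) = 1}`. -/
def Oc (I : BetaZero L) : Set (RL L) := {α | α ∈ Rc L ∧ I ⊔ rZero (coz α)ᶜ = ⊤}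

end BetaZero

end PointfreeReals

namespace PointfreeReals

universe u v

section Auxiliary

variable {L : Type u} [Order.Frame L]

/-! Everything rests on one reformulation, `mem_Oc_iff`: a member `α` of `ℛ_c L` lies in `𝐎_c^I` iff
`coz α ≤ x` for some complemented `x ∈ I`. The first claim follows, since such an `x` is the cozero
element of its characteristic function, which takes only the values 0 and 1, and `x ≺ x`. Given `Q`,
take for `I` the complemented elements below cozero elements of members of `Q`; then `Q ⊆ 𝐌_c^I` is
immediate. If `coz α ≤ x ≤ coz δ` with `δ ∈ Q`, then `δ` is invertible over `x`. Let `β` be `1/δ`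
over `x` and `0` over the complement. Its values are 0 and inverses of values of `δ`, so `β ∈ ℛ_c
L`, and `α(βδ) = α` lies in `Q`. To define `β` without points, `α` and `δ` are represented by
functions `f`, `g` on a space `X`, and `β` by a function on `D ⊕ X`, where `D = {g ≠ 0}` (`glue`,
`exists_mem_Rc_mul_mul_eq`). -/

/-- The open set of reals distinct from `r`. -/
def puncture (r : ℝ) : Opens ℝ := ⟨{r}ᶜ, isOpen_compl_singleton⟩

@[simp] theorem mem_puncture {r t : ℝ} : t ∈ puncture r ↔ t ≠ r := Iff.rfl

theorem coz_eq (α : RL L) : coz α = α (puncture 0) := by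
  rw [coz, ← map_sup]
  congr 1
  ext t
  exact (ne_iff_lt_or_gt (a := t) (b := 0)).symm

section

variable {T : Type v} [TopologicalSpace T]

theorem act_apply (P : FrameHom (Opens T) L) (f : C(T, ℝ)) (U : Opens ℝ) :
    act P f U = P (Opens.comap f U) := rfl

theorem coz_act_sub_const (P : FrameHom (Opens T) L) (f : C(T, ℝ)) (r : ℝ) :
    coz (act P f - const L r) = P (Opens.comap f (puncture r)) := by
  rw [← act_const P r, sub_eq_add_neg, ← act_neg, ← act_add, coz_eq, act_apply]
  congr 1
  ext t
  simp [← sub_eq_add_neg, sub_eq_zero]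

end

theorem coz_sub_const (α : RL L) (r : ℝ) : coz (α - const L r) = α (puncture r) :=
  -- Every `α` is represented by the identity function on `ℝ`, acted on by `α` itself.
  coz_act_sub_const α (ContinuousMap.id ℝ) r

theorem mem_pointfreeImage {α : RL L} {r : ℝ} :
    r ∈ pointfreeImage α ↔ α (puncture r) ≠ ⊤ := by
  rw [pointfreeImage, Set.mem_ofPred_eq, coz_sub_const]

/-- A sum of two squares is nonzero where one of the two summands is. -/
theorem coz_sq_add_sq (α β : RL L) : coz (α * α + β * β) = coz α ⊔ coz β := by
  obtain ⟨P, f, g, -, rfl, rfl, -⟩ := exists_act α β β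
  rw [← act_mul, ← act_mul, ← act_add, coz_eq, coz_eq, coz_eq, act_apply, act_apply, act_apply,
    ← map_sup]
  congr 1
  ext t
  simp only [Opens.coe_comap, Set.mem_preimage, SetLike.mem_coe, mem_puncture, Opens.coe_sup,
    Set.mem_union, ContinuousMap.add_apply, ContinuousMap.mul_apply, ne_eq,
    mul_self_add_mul_self_eq_zero]
  tauto

/-! ### Gluing along a complemented element -/

section Glue

variable {X : Type v} [TopologicalSpace X]

/-- The trace on `X` of the first summand of an open subset of `D ⊕ X`. -/
def leftPart (D : Opens X) (W : Opens (D ⊕ X)) : Opens X :=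
  ⟨Subtype.val '' (Sum.inl ⁻¹' (W : Set (D ⊕ X))),
    D.isOpen.isOpenMap_subtype_val _ (W.isOpen.preimage continuous_inl)⟩

/-- The second summand of an open subset of `D ⊕ X`. -/
def rightPart (D : Opens X) (W : Opens (D ⊕ X)) : Opens X :=
  ⟨Sum.inr ⁻¹' (W : Set (D ⊕ X)), W.isOpen.preimage continuous_inr⟩

theorem mem_leftPart {D : Opens X} {W : Opens (D ⊕ X)} {p : X} :
    p ∈ leftPart D W ↔ ∃ h : p ∈ D, Sum.inl ⟨p, h⟩ ∈ W := by
  constructor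
  · rintro ⟨q, hq, rfl⟩
    exact ⟨q.2, hq⟩
  · rintro ⟨h, hp⟩
    exact ⟨⟨p, h⟩, hp, rfl⟩

theorem mem_rightPart {D : Opens X} {W : Opens (D ⊕ X)} {p : X} :
    p ∈ rightPart D W ↔ Sum.inr p ∈ W := Iff.rfl

theorem leftPart_inf (D : Opens X) (W W' : Opens (D ⊕ X)) :
    leftPart D (W ⊓ W') = leftPart D W ⊓ leftPart D W' := by
  ext p
  simp only [SetLike.mem_coe, mem_leftPart, Opens.mem_inf]
  exact ⟨fun ⟨h, a, b⟩ => ⟨⟨h, a⟩, ⟨h, b⟩⟩, fun ⟨⟨h, a⟩, ⟨_, b⟩⟩ => ⟨h, a, b⟩⟩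

theorem leftPart_sSup (D : Opens X) (S : Set (Opens (D ⊕ X))) :
    leftPart D (sSup S) = ⨆ W ∈ S, leftPart D W := by
  ext p
  simp only [SetLike.mem_coe, mem_leftPart, Opens.mem_sSup, Opens.mem_iSup, exists_prop]
  exact ⟨fun ⟨h, W, hW, a⟩ => ⟨W, hW, h, a⟩, fun ⟨W, hW, h, a⟩ => ⟨h, W, hW, a⟩⟩

theorem rightPart_sSup (D : Opens X) (S : Set (Opens (D ⊕ X))) :
    rightPart D (sSup S) = ⨆ W ∈ S, rightPart D W := by
  ext p
  simp only [SetLike.mem_coe, mem_rightPart, Opens.mem_sSup, Opens.mem_iSup, exists_prop]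

/-- Given `ρ : 𝔒X → L` and complementary `x`, `y` with `x ≤ ρ D`, the frame homomorphism
`𝔒(D ⊕ X) → L` which is `ρ` on `D` over `x` and `ρ` on `X` over `y`. -/
def glue (ρ : FrameHom (Opens X) L) (D : Opens X) {x y : L} (hxy : IsCompl x y)
    (hx : x ≤ ρ D) : FrameHom (Opens (D ⊕ X)) L where
  toFun W := (x ⊓ ρ (leftPart D W)) ⊔ (y ⊓ ρ (rightPart D W))
  map_inf' W W' := by
    have h : rightPart D (W ⊓ W') = rightPart D W ⊓ rightPart D W' := rfl
    -- The cross terms of the two summands vanish because `x ⊓ y = ⊥`.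
    have h1 : ∀ a b : L, (x ⊓ a) ⊓ (y ⊓ b) = ⊥ := fun a b => by
      rw [inf_inf_inf_comm, hxy.inf_eq_bot, bot_inf_eq]
    have h2 : ∀ a b : L, (y ⊓ a) ⊓ (x ⊓ b) = ⊥ := fun a b => by rw [inf_comm, h1]
    rw [leftPart_inf, h, map_inf, map_inf, inf_sup_left, inf_sup_right, inf_sup_right, h1, h2,
      sup_bot_eq, bot_sup_eq, ← inf_inf_distrib_left, ← inf_inf_distrib_left]
  map_top' := by
    have h1 : leftPart D ⊤ = D := by
      ext p
      simp [mem_leftPart]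
    have h2 : rightPart D ⊤ = ⊤ := rfl
    rw [h1, h2, map_top, inf_top_eq, inf_eq_left.mpr hx, hxy.sup_eq_top]
  map_sSup' S := by
    rw [leftPart_sSup, rightPart_sSup, sSup_image]
    simp only [map_iSup, inf_iSup_eq, iSup_sup_eq]

variable {ρ : FrameHom (Opens X) L} {D : Opens X} {x y : L} (hxy : IsCompl x y) (hx : x ≤ ρ D)

theorem glue_apply (W : Opens (D ⊕ X)) :
    glue ρ D hxy hx W = (x ⊓ ρ (leftPart D W)) ⊔ (y ⊓ ρ (rightPart D W)) := rfl

/-- The continuous function on `D ⊕ X` with the given restrictions to the summands. -/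
def sumElim {D : Opens X} (f : C(D, ℝ)) (g : C(X, ℝ)) : C(D ⊕ X, ℝ) :=
  ⟨Sum.elim f g, f.continuous.sumElim g.continuous⟩

/-- Restricting a function to both summands and gluing gives the same element of `ℛL`. -/
theorem act_glue_restrict (f : C(X, ℝ)) :
    act (glue ρ D hxy hx) (sumElim (f.restrict D) f) = act ρ f := by
  refine FrameHom.ext fun U => ?_
  have h : leftPart D (Opens.comap (sumElim (f.restrict D) f) U) = D ⊓ Opens.comap f U := by
    ext p
    rw [SetLike.mem_coe, mem_leftPart]
    exact exists_prop (a := p ∈ D) (b := f p ∈ U)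
  have h' : rightPart D (Opens.comap (sumElim (f.restrict D) f) U) = Opens.comap f U := rfl
  rw [act_apply, act_apply, glue_apply, h, h', map_inf, ← inf_assoc, inf_eq_left.mpr hx,
    ← inf_sup_right, hxy.sup_eq_top, top_inf_eq]

/-- An element of `ℛL` whose cozero part lies under `x` may be replaced by `0` over the
complement `y` of `x`. -/
theorem act_glue_restrict_zero (f : C(X, ℝ)) (hf : coz (act ρ f) ≤ x) :
    act (glue ρ D hxy hx) (sumElim (f.restrict D) 0) = act ρ f := by
  rw [← act_glue_restrict hxy hx f]
  refine FrameHom.ext fun U => ?_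
  have hl : leftPart D (Opens.comap (sumElim (f.restrict D) 0) U) =
    leftPart D (Opens.comap (sumElim (f.restrict D) f) U) := rfl
  rw [act_apply, act_apply, glue_apply, glue_apply, hl]
  congr 1
  have hr : rightPart D (Opens.comap (sumElim (f.restrict D) f) U) = Opens.comap f U := rfl
  have hr0 : rightPart D (Opens.comap (sumElim (f.restrict D) 0) U) =
    Opens.comap (0 : C(X, ℝ)) U := rfl
  have hf' : ρ (Opens.comap f (puncture 0)) ≤ x := by rwa [coz_eq, act_apply] at hf
  rw [hr, hr0]
  -- Only the parts over `y` differ. If `0 ∈ U`, then `{f ≠ 0}` and the preimage of `U` cover `X`,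
  -- so that preimage contributes all of `y`. Otherwise it lies in `{f ≠ 0}`, hence under `x`, and
  -- contributes nothing.
  by_cases h0 : (0 : ℝ) ∈ U
  · have h1 : Opens.comap (0 : C(X, ℝ)) U = ⊤ := by
      ext p
      simp [h0]
    have h2 : Opens.comap f (puncture 0) ⊔ Opens.comap f U = ⊤ := by
      ext p
      by_cases hp : f p = 0 <;> simp [hp, h0]
    have h3 : x ⊔ ρ (Opens.comap f U) = ⊤ := by
      refine top_le_iff.mp ?_
      rw [← map_top ρ, ← h2, map_sup]
      exact sup_le_sup_right hf' _
    have h4 : y ≤ ρ (Opens.comap f U) := hxy.symm.disjoint.le_of_codisjoint (codisjoint_iff.mpr h3)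
    rw [h1, map_top, inf_top_eq, inf_eq_left.mpr h4]
  · have h1 : Opens.comap (0 : C(X, ℝ)) U = ⊥ := by
      ext p
      simp [h0]
    have h2 : Opens.comap f U ≤ Opens.comap f (puncture 0) := fun p hp hp0 =>
      h0 (by rw [← show f p = 0 from hp0]; exact hp)
    have h3 : y ⊓ ρ (Opens.comap f U) = ⊥ :=
      le_bot_iff.mp ((inf_le_inf_left y ((OrderHomClass.mono ρ h2).trans hf')).trans
        hxy.symm.inf_eq_bot.le)
    rw [h1, map_bot, inf_bot_eq, h3]

end Glue

/-! ### Characteristic functions and partial inverses in `ℛ_c L` -/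

/-- Complemented elements are cozero elements of members of `ℛ_c L`. -/
theorem exists_mem_Rc_coz_eq {x : L} (hx : IsComplemented x) : ∃ δ ∈ Rc L, coz δ = x := by
  obtain ⟨y, hxy⟩ := hx
  have hle : x ≤ (0 : RL L) ⊤ := by rw [map_top]; exact le_top
  -- The function is 1 over `x` and 0 over `y`; the homomorphism `0` on `𝔒ℝ` is an arbitrary choice
  -- of base.
  refine ⟨act (glue (0 : RL L) ⊤ hxy hle) (sumElim 1 0), ?_, ?_⟩
  · refine Set.Countable.mono ?_ (Set.toFinite ({0, 1} : Set ℝ)).countable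
    intro r hr
    by_contra hr'
    simp only [Set.mem_insert_iff, Set.mem_singleton_iff, not_or] at hr'
    refine mem_pointfreeImage.mp hr ?_
    rw [act_apply, ← map_top (glue (0 : RL L) ⊤ hxy hle)]
    congr 1
    ext (t | t)
    · simpa [sumElim] using Ne.symm hr'.2
    · simpa [sumElim] using Ne.symm hr'.1
  · have hl : leftPart ⊤ (Opens.comap (sumElim 1 0) (puncture 0)) = (⊤ : Opens ℝ) := by
      ext t
      simp [mem_leftPart, sumElim]
    have hr : rightPart ⊤ (Opens.comap (sumElim 1 0) (puncture 0)) = (⊥ : Opens ℝ) := by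
      ext t
      simp [mem_rightPart, sumElim]
    rw [coz_eq, act_apply, glue_apply, hl, hr, map_top, map_bot, inf_top_eq, inf_bot_eq,
      sup_bot_eq]

/-- If a complemented element separates `coz α` from the complement of `coz δ`, then `α` is a
multiple of `δ` by way of a member of `ℛ_c L`. -/
theorem exists_mem_Rc_mul_mul_eq {α δ : RL L} (hδ : δ ∈ Rc L) {x : L} (hx : IsComplemented x)
    (hαx : coz α ≤ x) (hxδ : x ≤ coz δ) : ∃ β ∈ Rc L, α * (β * δ) = α := by
  obtain ⟨y, hxy⟩ := hx
  obtain ⟨ρ, f, g, -, rfl, rfl, -⟩ := exists_act α δ δ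
  rw [coz_eq (act ρ g), act_apply] at hxδ
  set D := Opens.comap g (puncture 0) with hD
  have hg : ∀ p : D, g p ≠ 0 := fun p => p.2
  let i : C(D, ℝ) := ⟨fun p => (g p)⁻¹, (g.continuous.comp continuous_subtype_val).inv₀ hg⟩
  set P := glue ρ D hxy hxδ with hP
  refine ⟨act P (sumElim i 0), ?_, ?_⟩
  · refine Set.Countable.mono ?_ ((hδ.image fun r => r⁻¹).insert 0)
    intro r hr
    by_contra hr'
    rw [Set.mem_insert_iff, not_or] at hr'
    have hr1 : ρ (Opens.comap g (puncture r⁻¹)) = ⊤ := by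
      by_contra h
      exact hr'.2 ⟨r⁻¹, mem_pointfreeImage.mpr h, inv_inv r⟩
    refine mem_pointfreeImage.mp hr ?_
    -- On `D`, `1/g` avoids `r` exactly where `g` avoids `1/r`; on the other summand the value is 0,
    -- which is why 0 was inserted.
    have hl : leftPart D (Opens.comap (sumElim i 0) (puncture r)) =
        D ⊓ Opens.comap g (puncture r⁻¹) := by
      ext p
      simp [mem_leftPart, sumElim, i, inv_eq_iff_eq_inv]
    have hrt : rightPart D (Opens.comap (sumElim i 0) (puncture r)) = ⊤ := by
      ext p
      simpa [mem_rightPart, sumElim] using Ne.symm hr'.1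
    rw [act_apply, hP, glue_apply, hl, hrt, map_inf, hr1, map_top, inf_top_eq, inf_top_eq,
      inf_eq_left.mpr hxδ, hxy.sup_eq_top]
  · conv_lhs => rw [← act_glue_restrict hxy hxδ f, ← act_glue_restrict hxy hxδ g, ← hP,
      ← act_mul, ← act_mul]
    -- With the right-hand `α` represented by `0` on the second summand, the identity holds
    -- pointwise on `D ⊕ X`.
    rw [← act_glue_restrict_zero hxy hxδ f hαx]
    congr 1
    ext (p | p)
    · change f p * ((g p)⁻¹ * g p) = f p
      rw [inv_mul_cancel₀ (hg p), mul_one]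
    · simp [sumElim]

/-! ### The sets `𝐎_c^I` and the relation `≺≺` -/

/-- `α ∈ 𝐎_c^I` says that `coz α` lies below some member of `I`. -/
theorem mem_Oc_iff {I : BetaZero L} {α : RL L} :
    α ∈ Oc I ↔ α ∈ Rc L ∧ ∃ x ∈ I, coz α ≤ (x : L) := by
  refine and_congr_right fun _ => ?_
  constructor
  · intro h
    have htop : (⊤ : Complementeds L) ∈ I ⊔ rZero (coz α)ᶜ := h ▸ trivial
    -- Here `z` is disjoint from `coz α` and `x ⊔ z = ⊤`, which forces `coz α ≤ x`.
    obtain ⟨x, hx, z, hz, hxz⟩ := Order.Ideal.mem_sup.mp htop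
    have hxz' : (x : L) ⊔ z = ⊤ := top_le_iff.mp hxz
    have hdis : Disjoint (coz α) (z : L) := le_compl_iff_disjoint_left.mp hz
    exact ⟨x, hx, hdis.le_of_codisjoint (codisjoint_iff.mpr hxz').symm⟩
  · rintro ⟨x, hx, hαx⟩
    obtain ⟨y, hxy⟩ := x.2
    have hy : (⟨y, x, hxy.symm⟩ : Complementeds L) ∈ rZero (coz α)ᶜ :=
      le_compl_iff_disjoint_left.mpr (hxy.disjoint.mono_left hαx)
    refine Order.Ideal.top_of_top_mem (Order.Ideal.mem_sup.mpr ⟨x, hx, _, hy, ?_⟩)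
    exact hxy.sup_eq_top.ge

theorem CompletelyBelow.le {a b : L} (h : CompletelyBelow a b) : a ≤ b := by
  obtain ⟨s, rfl, rfl, hs⟩ := h
  have h01 : (s 0)ᶜ ⊔ s 1 = ⊤ := hs 0 1 (Subtype.mk_lt_mk.mpr zero_lt_one)
  exact disjoint_compl_right.le_of_codisjoint (codisjoint_iff.mpr h01)

/-- Anything below a complemented element is completely below it. -/
theorem completelyBelow_of_le {a x : L} (hx : IsComplemented x) (h : a ≤ x) :
    CompletelyBelow a x := by
  obtain ⟨y, hxy⟩ := hx
  have hxx : xᶜ ⊔ x = ⊤ := by rw [hxy.compl_eq, sup_comm, hxy.sup_eq_top]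
  -- Since `x ≺ x`, a family that jumps to `x` right after 0 is enough.
  refine ⟨fun q => if q = 0 then a else x, if_pos rfl, if_neg fun h => one_ne_zero (congrArg Subtype.val h),
    fun p q hpq => ?_⟩
  have hq : q ≠ 0 := fun h => (lt_of_le_of_lt p.2.1 (Subtype.coe_lt_coe.mpr hpq)).ne' (congrArg Subtype.val h)
  simp only [RatherBelow, if_neg hq]
  refine top_le_iff.mp (hxx.ge.trans (sup_le_sup_right (compl_le_compl ?_) x))
  split_ifs
  exacts [h, le_rfl]

/-- The complemented elements lying below the cozero element of some member of `Q`. -/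
def cozIdeal {Q : Set (RL L)} (hQ : IsRcIdeal Q) : BetaZero L where
  carrier := {x | ∃ δ ∈ Q, (x : L) ≤ coz δ}
  lower' := fun _ _ hyx ⟨δ, hδ, hx⟩ => ⟨δ, hδ, le_trans (show _ ≤ _ from hyx) hx⟩
  nonempty' := ⟨⊥, 0, hQ.zero_mem, bot_le⟩
  directed' := fun x ⟨α, hα, hx⟩ z ⟨β, hβ, hz⟩ =>
    -- Squares prevent cancellation in the sum, so its cozero element is the full join.
    ⟨x ⊔ z, ⟨α * α + β * β,
      hQ.add_mem (hQ.mul_mem (hQ.subset hα) hα) (hQ.mul_mem (hQ.subset hβ) hβ),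
      (sup_le_sup hx hz).trans (coz_sq_add_sq α β).ge⟩, le_sup_left, le_sup_right⟩

end Auxiliary

end PointfreeReals

open PointfreeReals in
theorem proposition5p4 {L : Type*} [Order.Frame L] :
    (∀ I : BetaZero L, Oc I = {α | α ∈ Rc L ∧ ∃ δ ∈ Rc L,
      CompletelyBelow (coz α) (coz δ) ∧ ∃ b ∈ I, (b : L) = coz δ}) ∧
    ∀ Q : Set (RL L), IsRcIdeal Q → ∃ I : BetaZero L, Oc I ⊆ Q ∧ Q ⊆ Mc I := by
  refine ⟨fun I => Set.ext fun α => ?_, fun Q hQ => ⟨cozIdeal hQ, fun α hα => ?_, fun α hα => ?_⟩⟩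
  · rw [mem_Oc_iff]
    refine and_congr_right fun _ => ⟨?_, ?_⟩
    · rintro ⟨x, hx, hαx⟩
      obtain ⟨δ, hδ, hδx⟩ := exists_mem_Rc_coz_eq x.2
      exact ⟨δ, hδ, hδx ▸ completelyBelow_of_le x.2 hαx, x, hx, hδx.symm⟩
    · rintro ⟨δ, -, h, x, hx, hxδ⟩
      exact ⟨x, hx, hxδ ▸ h.le⟩
  · obtain ⟨hα, x, ⟨δ, hδ, hxδ⟩, hαx⟩ := mem_Oc_iff.mp hα
    obtain ⟨β, hβ, h⟩ := exists_mem_Rc_mul_mul_eq (hQ.subset hδ) x.2 hαx hxδ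
    -- This bracketing uses only the absorption law of `Q`, not closure of `ℛ_c L` under products.
    exact h ▸ hQ.mul_mem hα (hQ.mul_mem hβ hδ)
  · exact ⟨hQ.subset hα, fun x hx => ⟨α, hα, hx⟩⟩
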